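/- Fractional knapsack: an instance $\mathcal I$ consists of $n$ items, where item $i$ has a size $s_i\in\mathbb{Q}_{>0}$ and a profit $v_i\in\mathbb{Q}_{\ge 0}$, and of a capacity $W\in\mathbb{Q}_{>0}$. A packing is a vector $x\in([0,1]\cap\mathbb{Q})^n$ with $\sum_i s_ix_i\le W$, and $\mathrm{OPT}(\mathcal I)$ is the largest profit $\sum_i v_ix_i$ of a packing. In the online problem in the random order model, $n$ and $W$ are known, the items arrive one by one in a uniformly random order, and an item reveals its size, its profit and its identifier (items have distinct identifiers, which serve only to break ties) on arrival; the fraction $x_i$ of it must be fixed immediately and irrevocably. Theorem. There is a deterministic online algorithm $\mathcal A$ for the fractional knapsack problem in the random order model that always outputs a packing and is $4.39$-competitive: there is a sequence $\varepsilon_n\to 0$ such that for every $n$ and every instance $\mathcal I$ with $n$ items $$\mathbb{E}[\mathcal A(\mathcal I)]\ \ge\ \Bigl(\frac{1}{4.39}-\varepsilon_n\Bigr)\cdot \mathrm{OPT}(\mathcal I),$$ where the expectation of the profit $\mathcal A(\mathcal I)$ of the algorithm is over the uniformly random order of arrival. Specifically, this holds for the following algorithm with $c=0.47521$ and $d=0.60138$.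 Let $i$ be the item that arrives in round $\ell$, and let $R=W-\sum_j s_jx_j$, with the sum over the items $j$ of rounds $1,\dots,\ell-1$, be the free capacity. (1) Sampling phase, $\ell\le\lfloor cn\rfloor$: set $x_i=0$. (2) Secretary phase, $\lfloor cn\rfloor<\ell\le\lfloor dn\rfloor$: if item $i$ is more profitable than every item of the sampling phase, set $x_i=\frac1{s_i}\min\{s_i,R\}$, and otherwise set $x_i=0$. (3) Knapsack phase, $\lfloor dn\rfloor<\ell\le n$: set $x_i=\frac1{s_i}\min\{s_i x^{(\ell)}_i,R\}$, where $x^{(\ell)}$ is the optimal fractional packing for the items of rounds $1,\dots,\ell$ that packs items in decreasing order of density $v_j/s_j$, each to the largest extent that the remaining space permits. In (2) the profit of an item of size larger than $W$ is taken to be $v_jW/s_j$ (the item is cut at the capacity), and equal profits are compared by identifier; in (3) equal densities are compared by these profits and then by identifier. -/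

import Mathlib

open Filter Topology

namespace FractionalKnapsack

/-- An item, as it is revealed on arrival: an identifier (which the algorithm below uses only to
break ties consistently), a size and a profit. -/
structure Item where
  id : ℕ
  size : ℚ
  value : ℚ

/-- An instance of the fractional knapsack problem with `n` items. Sizes may exceed the capacity
and several items may have the same profit. -/
structure Instance (n : ℕ) where
  item : Fin n → Item
  id_injective : Function.Injective fun i => (item i).id
  size_pos : ∀ i, 0 < (item i).size
  value_nonneg : ∀ i, 0 ≤ (item i).value
  capacity : ℚ
  capacity_pos : 0 < capacity

namespace Instance

variable {n : ℕ}

/-- `x` is a feasible fractional packing: a fraction `x i ∈ [0, 1]` of every item `i`, of total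
size at most the capacity. -/
def IsPacking (I : Instance n) (x : Fin n → ℚ) : Prop :=
  (∀ i, 0 ≤ x i ∧ x i ≤ 1) ∧ ∑ i, (I.item i).size * x i ≤ I.capacity

/-- The total profit of a packing. -/
def profit (I : Instance n) (x : Fin n → ℚ) : ℚ :=
  ∑ i, (I.item i).value * x i

/-- The offline optimum: the largest profit of a feasible fractional packing. The set is nonempty
(it contains `0`) and bounded above by the sum of all profits. -/
noncomputable def opt (I : Instance n) : ℝ :=
  sSup {p : ℝ | ∃ x : Fin n → ℚ, I.IsPacking x ∧ p = (I.profit x : ℝ)}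

/-- The items in their order of arrival, where item `i` arrives in round `π i`. -/
def arrivals (I : Instance n) (π : Equiv.Perm (Fin n)) : List Item :=
  List.ofFn fun ℓ => I.item (π.symm ℓ)

end Instance

/-- A deterministic online algorithm. It knows the number `n` of items and the capacity `W`. When
an item arrives, it chooses the fraction of this item that is packed, as a function of the items
of the earlier rounds, in order of arrival and with the fractions chosen for them, and of the
arriving item. -/
def OnlineAlgorithm : Type :=
  (n : ℕ) → (W : ℚ) → (past : List (Item × ℚ)) → (current : Item) → ℚ

namespace OnlineAlgorithm

/-- The items of a sequence of arrivals, each with the fraction that `A` packs of it. -/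
def history (A : OnlineAlgorithm) (n : ℕ) (W : ℚ) (arrived : List Item) : List (Item × ℚ) :=
  arrived.foldl (fun past i => past ++ [(i, A n W past i)]) []

/-- The fraction of item `i` that `A` packs when the items arrive in the order `π`: the decision
on item `i` after the items of the rounds before `π i`. -/
def packing (A : OnlineAlgorithm) {n : ℕ} (I : Instance n) (π : Equiv.Perm (Fin n)) (i : Fin n) :
    ℚ :=
  A n I.capacity (A.history n I.capacity ((I.arrivals π).take (π i))) (I.item i)

/-- On every instance and for every order of arrival, `A` outputs a feasible packing. -/
def IsFeasible (A : OnlineAlgorithm) : Prop :=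
  ∀ (n : ℕ) (I : Instance n) (π : Equiv.Perm (Fin n)), I.IsPacking (A.packing I π)

/-- The expected profit of `A` when the order of arrival is a uniformly random permutation. -/
def expectedProfit (A : OnlineAlgorithm) {n : ℕ} (I : Instance n) : ℚ :=
  (∑ π : Equiv.Perm (Fin n), I.profit (A.packing I π)) / (n.factorial : ℚ)

/-- `A` is `r`-competitive in the random order model: its expected profit is at least
`(1 / r - o(1)) * opt` on all instances, where the `o(1)` depends on the number of items only. -/
def IsCompetitive (A : OnlineAlgorithm) (r : ℝ) : Prop :=
  ∃ ε : ℕ → ℝ, Tendsto ε atTop (𝓝 0) ∧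
    ∀ (n : ℕ) (I : Instance n), (1 / r - ε n) * I.opt ≤ (A.expectedProfit I : ℝ)

end OnlineAlgorithm

namespace Item

/-- Profit per unit of size. -/
def density (i : Item) : ℚ := i.value / i.size

/-- The profit of the item after it is cut at the capacity `W`. This is the profit of the item
itself if its size is at most `W`. -/
def cutValue (W : ℚ) (i : Item) : ℚ := i.value * min 1 (W / i.size)

/-- Items are compared by profit (after cutting), with ties broken by the identifier. -/
def profitKey (W : ℚ) (i : Item) : ℚ ×ₗ ℕ := toLex (i.cutValue W, i.id)

/-- Items are compared by density, with ties broken by profit (after cutting), then by the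
identifier. -/
def densityKey (W : ℚ) (i : Item) : ℚ ×ₗ ℚ ×ₗ ℕ := toLex (i.density, i.profitKey W)

end Item

/-- The fraction of item `i ∈ Q` in the optimal fractional solution for the item set `Q` and
capacity `W`. This solution packs the items in order of decreasing density, each to the largest
extent that the space left by the denser items permits. -/
def optimalFraction (W : ℚ) (Q : List Item) (i : Item) : ℚ :=
  max 0 (min 1
    ((W - ((Q.filter fun j => i.densityKey W < j.densityKey W).map Item.size).sum) / i.size))

/-- The three-phase algorithm with parameters `c ≤ d`. The current round is `past.length + 1`.
* Rounds `1, …, ⌊c n⌋` (sampling): nothing is packed.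
* Rounds `⌊c n⌋ + 1, …, ⌊d n⌋` (secretary): an item that is more profitable than all items of
  the sampling phase is packed to the largest extent that the free capacity permits.
* Rounds `⌊d n⌋ + 1, …, n` (knapsack): the item is packed to the extent to which it is in the
  optimal fractional solution for the items revealed so far, as far as the free capacity
  permits. -/
def threePhase (c d : ℚ) : OnlineAlgorithm := fun n W past i =>
  let free : ℚ := W - (past.map fun p => p.1.size * p.2).sum
  if past.length < ⌊c * n⌋₊ then 0
  else if past.length < ⌊d * n⌋₊ then
    if ∀ p ∈ past.take ⌊c * n⌋₊, p.1.profitKey W < i.profitKey W then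
      1 / i.size * min i.size free
    else 0
  else
    1 / i.size * min (i.size * optimalFraction W (past.map Prod.fst ++ [i]) i) free

end FractionalKnapsack

/-!
The knapsack phase alone earns the claimed share of the optimum, so the profit of the secretary
phase is dropped; that phase matters only because it may use up capacity. Rounds are counted from
`0`; let `C = ⌊c n⌋` and `D = ⌊d n⌋`, let `W` be the capacity, and let `x⁽ℓ⁾` be the greedy packing
of the items revealed up to round `ℓ`.

* If the most profitable of the first `D` items arrives in the first `C` rounds, then the secretary
  phase packs nothing. This event has probability `C / D` and is independent of the set of the first
  `D` items and of all that happens later (`mul_sum_noSecretary`).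
* On this event, the free capacity in round `ℓ ≥ D` is at least `W` minus the loads
  `s_i x⁽ᵖ⁾_i` of the items `i` of the rounds `p = D, …, ℓ - 1` (`capacity_sub_le_free`). Given the
  set of the first `p + 1` items, the last of them is uniformly random, and `x⁽ᵖ⁾` has total size at
  most `W`, so the expected load of round `p` is at most `W / (p + 1)`, also if all rounds after `p`
  are fixed (`sum_gain_mul_load_le`).
* With free capacity `R`, the item of round `ℓ` is packed to the extent `min (s_i x⁽ℓ⁾_i) R / s_i`,
  which is at least `x⁽ℓ⁾_i R / W`, as neither `s_i x⁽ℓ⁾_i` nor `R` exceeds `W` (`gain_mul_le`).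
* The greedy packing is optimal (`Instance.sum_value_mul_le_greedy`), so that the expected gain
  `v_i x⁽ℓ⁾_i` of round `ℓ` is at least `OPT / n` (`factorial_mul_profit_le_sum_gain`).

Together, round `ℓ ≥ D` contributes at least
`(C / D) (OPT / n) (1 - ∑_{p = D}^{ℓ - 1} 1 / (p + 1))`. The sum over `ℓ` is
`(C / D) (2 (1 - D / n) - ∑_{p = D}^{n - 1} 1 / (p + 1)) OPT`, and its coefficient tends to `(c / d) (2 - 2 d + log d)`. This is about `0.2281` for the given parameters,
while `1 / 4.39` is about `0.2278`.

Expectations are sums over all permutations. Their symmetry is used through one lemma,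
`mul_sum_symm_apply`: exchanging two rounds permutes the summands, so that each of the first `m`
items is equally often the item of round `p < m`.
-/

namespace FractionalKnapsack

variable {n : ℕ}

/-! ### The greedy packing -/

namespace Instance

/-- The density key of item `i` of the instance: the order in which the greedy packing proceeds. -/
def greedyKey (I : Instance n) (i : Fin n) : ℚ ×ₗ ℚ ×ₗ ℕ := (I.item i).densityKey I.capacity

/-- The profit key of item `i` of the instance: the order of the secretary phase. -/
def secretaryKey (I : Instance n) (i : Fin n) : ℚ ×ₗ ℕ := (I.item i).profitKey I.capacity

/-- The fraction of item `i` in the greedy packing of the set `S` of items. This is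
`optimalFraction`, with a finite set of indices in place of the list of items. -/
def greedy (I : Instance n) (S : Finset (Fin n)) (i : Fin n) : ℚ :=
  max 0 (min 1 ((I.capacity - ∑ j ∈ S with I.greedyKey i < I.greedyKey j, (I.item j).size) /
    (I.item i).size))

lemma secretaryKey_injective (I : Instance n) : Function.Injective I.secretaryKey := by
  intro i j h
  apply I.id_injective
  exact congrArg (fun p => (ofLex p).2) h

lemma greedyKey_injective (I : Instance n) : Function.Injective I.greedyKey := by
  intro i j h
  apply I.id_injective
  exact congrArg (fun p => (ofLex (ofLex p).2).2) h

lemma density_le_of_greedyKey_le (I : Instance n) {i j : Fin n}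
    (h : I.greedyKey i ≤ I.greedyKey j) : (I.item i).density ≤ (I.item j).density := by
  have h' := Prod.Lex.toLex_le_toLex.1 h
  rcases h' with h' | h'
  · exact h'.le
  · exact h'.1.le

lemma density_nonneg (I : Instance n) (i : Fin n) : 0 ≤ (I.item i).density :=
  div_nonneg (I.value_nonneg i) (I.size_pos i).le

lemma value_eq_density_mul_size (I : Instance n) (i : Fin n) :
    (I.item i).value = (I.item i).density * (I.item i).size :=
  (div_mul_cancel₀ _ (I.size_pos i).ne').symm

lemma greedy_nonneg (I : Instance n) (S : Finset (Fin n)) (i : Fin n) : 0 ≤ I.greedy S i :=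
  le_max_left _ _

lemma greedy_le_one (I : Instance n) (S : Finset (Fin n)) (i : Fin n) : I.greedy S i ≤ 1 :=
  max_le zero_le_one (min_le_left _ _)

/-- Adding an item of smaller density does not change the fractions of the other items. -/
lemma sum_mul_greedy_insert (I : Instance n) {S : Finset (Fin n)} {m : Fin n}
    (h : ∀ i ∈ S, I.greedyKey m < I.greedyKey i) (w : Fin n → ℚ) :
    ∑ i ∈ S, w i * I.greedy (insert m S) i = ∑ i ∈ S, w i * I.greedy S i := by
  refine Finset.sum_congr rfl fun i hi => ?_
  unfold greedy
  rw [Finset.filter_insert, if_neg (h i hi).not_gt]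

lemma size_mul_greedy_insert_self (I : Instance n) {S : Finset (Fin n)} {m : Fin n}
    (h : ∀ i ∈ S, I.greedyKey m < I.greedyKey i) :
    (I.item m).size * I.greedy (insert m S) m =
      max 0 (min (I.item m).size (I.capacity - ∑ j ∈ S, (I.item j).size)) := by
  have hs := I.size_pos m
  unfold greedy
  rw [Finset.filter_insert, if_neg (lt_irrefl _), Finset.filter_true_of_mem h,
    mul_max_of_nonneg _ _ hs.le, mul_min_of_nonneg _ _ hs.le, mul_zero, mul_one,
    mul_div_cancel₀ _ hs.ne']

/-- The greedy packing fills the capacity, unless all items fit. -/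
lemma sum_size_mul_greedy (I : Instance n) (S : Finset (Fin n)) :
    ∑ i ∈ S, (I.item i).size * I.greedy S i = min I.capacity (∑ i ∈ S, (I.item i).size) := by
  induction S using Finset.induction_on_min_value I.greedyKey with
  | empty => simp [I.capacity_pos.le]
  | insert m S hm hle ih =>
    have hlt : ∀ i ∈ S, I.greedyKey m < I.greedyKey i := fun i hi =>
      lt_of_le_of_ne (hle i hi) fun h => hm (I.greedyKey_injective h ▸ hi)
    have hs := I.size_pos m
    rw [Finset.sum_insert hm, Finset.sum_insert hm, I.size_mul_greedy_insert_self hlt,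
      I.sum_mul_greedy_insert hlt, ih]
    rcases le_total I.capacity (∑ i ∈ S, (I.item i).size) with h | h <;> grind

/-- The greedy packing is an optimal packing of `S`. The parameter `θ` makes the induction over
the items by decreasing density work: the greedy packing is never behind in packed size, so its
lead in profit is at least its lead in size times the least density so far. -/
lemma density_mul_le_greedy_sub (I : Instance n) (S : Finset (Fin n)) (y : Fin n → ℚ)
    (hy : ∀ i, 0 ≤ y i ∧ y i ≤ 1) (hW : ∑ i, (I.item i).size * y i ≤ I.capacity) (θ : ℚ)
    (hS : ∀ i ∈ S, θ ≤ (I.item i).density) :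
    θ * (∑ i ∈ S, (I.item i).size * I.greedy S i - ∑ i ∈ S, (I.item i).size * y i) ≤
      ∑ i ∈ S, (I.item i).value * I.greedy S i - ∑ i ∈ S, (I.item i).value * y i := by
  induction S using Finset.induction_on_min_value I.greedyKey generalizing θ with
  | empty => simp
  | insert m S hm hle ih =>
    have hlt : ∀ i ∈ S, I.greedyKey m < I.greedyKey i := fun i hi =>
      lt_of_le_of_ne (hle i hi) fun h => hm (I.greedyKey_injective h ▸ hi)
    have hlead : 0 ≤ ∑ i ∈ insert m S, (I.item i).size * I.greedy (insert m S) i -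
        ∑ i ∈ insert m S, (I.item i).size * y i := by
      rw [I.sum_size_mul_greedy, sub_nonneg]
      refine le_min (le_trans ?_ hW) (Finset.sum_le_sum fun i _ => ?_)
      · exact Finset.sum_le_univ_sum_of_nonneg fun i => mul_nonneg (I.size_pos i).le (hy i).1
      · exact mul_le_of_le_one_right (I.size_pos i).le (hy i).2
    refine (mul_le_mul_of_nonneg_right (hS m (Finset.mem_insert_self _ _)) hlead).trans ?_
    have := ih (I.item m).density fun i hi => I.density_le_of_greedyKey_le (hle i hi)
    simp only [Finset.sum_insert hm]
    rw [I.sum_mul_greedy_insert hlt, I.sum_mul_greedy_insert hlt, I.value_eq_density_mul_size m]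
    linarith

lemma sum_value_mul_le_greedy (I : Instance n) (S : Finset (Fin n)) {y : Fin n → ℚ}
    (hy : I.IsPacking y) :
    ∑ i ∈ S, (I.item i).value * y i ≤ ∑ i ∈ S, (I.item i).value * I.greedy S i := by
  have := I.density_mul_le_greedy_sub S y hy.1 hy.2 0 fun i _ => I.density_nonneg i
  linarith

end Instance

/-! ### Symmetry of the random order -/

/-- The items of the first `m` rounds, when item `i` arrives in round `π i`. -/
def arrived (π : Equiv.Perm (Fin n)) (m : ℕ) : Finset (Fin n) := {i | (π i : ℕ) < m}

@[simp]
lemma mem_arrived {π : Equiv.Perm (Fin n)} {m : ℕ} {i : Fin n} :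
    i ∈ arrived π m ↔ (π i : ℕ) < m := by
  simp [arrived]

/-- The function `F` of the order of arrival does not depend on the order among the first `m`
rounds. Transpositions of rounds suffice, as they generate all permutations of these rounds. -/
def IsPrefixSymmetric {α : Type*} (m : ℕ) (F : Equiv.Perm (Fin n) → α) : Prop :=
  ∀ j k : Fin n, (j : ℕ) < m → (k : ℕ) < m → ∀ π, F (Equiv.swap j k * π) = F π

lemma swap_mul_symm_apply (j k ℓ : Fin n) (π : Equiv.Perm (Fin n)) :
    (Equiv.swap j k * π).symm ℓ = π.symm (Equiv.swap j k ℓ) := by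
  rw [Equiv.symm_apply_eq]
  simp

lemma isPrefixSymmetric_arrived {m p : ℕ} (h : m ≤ p) :
    IsPrefixSymmetric m fun π : Equiv.Perm (Fin n) => arrived π p := by
  intro j k hj hk π
  ext i
  simp only [mem_arrived, Equiv.Perm.mul_apply, Equiv.swap_apply_def]
  split_ifs with h1 h2
  · rw [h1]; omega
  · rw [h2]; omega
  · rfl

lemma isPrefixSymmetric_symm_apply {m : ℕ} (ℓ : Fin n) (h : m ≤ ℓ) :
    IsPrefixSymmetric m fun π : Equiv.Perm (Fin n) => π.symm ℓ := by
  intro j k hj hk π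
  have hj' : ℓ ≠ j := fun e => by rw [e] at h; omega
  have hk' : ℓ ≠ k := fun e => by rw [e] at h; omega
  simp only [swap_mul_symm_apply, Equiv.swap_apply_of_ne_of_ne hj' hk']

lemma sum_rounds_eq_sum_arrived (π : Equiv.Perm (Fin n)) (m : ℕ) (f : Fin n → ℚ) :
    ∑ p : Fin n with Fin.val p < m, f (π.symm p) = ∑ i ∈ arrived π m, f i := by
  refine Finset.sum_bij' (fun p _ => π.symm p) (fun i _ => π i) ?_ ?_ ?_ ?_ ?_ <;> simp

/-- Given the set of the items of the first `m` rounds, each of these items is equally likely to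
arrive in round `p < m`. -/
lemma mul_sum_symm_apply {m : ℕ} (hm : m ≤ n) (H : Equiv.Perm (Fin n) → Fin n → ℚ)
    (hH : IsPrefixSymmetric m H) (p : Fin n) (hp : (p : ℕ) < m) :
    (m : ℚ) * ∑ π, H π (π.symm p) = ∑ π, ∑ i ∈ arrived π m, H π i := by
  have key : ∀ j ∈ ({j : Fin n | (j : ℕ) < m} : Finset (Fin n)),
      ∑ π, H π (π.symm j) = ∑ π, H π (π.symm p) := by
    intro j hj
    rw [← Equiv.sum_comp (Equiv.mulLeft (Equiv.swap j p)) fun π => H π (π.symm p)]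
    refine Finset.sum_congr rfl fun π _ => ?_
    rw [Equiv.coe_mulLeft, swap_mul_symm_apply, Equiv.swap_apply_right,
      hH j p (by simpa using hj) hp]
  simp_rw [← sum_rounds_eq_sum_arrived]
  rw [Finset.sum_comm, Finset.sum_congr rfl key, Finset.sum_const, Fin.card_filter_val_lt,
    min_eq_right hm, nsmul_eq_mul]

/-! ### The run of the algorithm on a fixed order of arrival -/

lemma mem_take_finRange {m : ℕ} {p : Fin n} : p ∈ (List.finRange n).take m ↔ (p : ℕ) < m := by
  rw [List.mem_take_iff_getElem]
  constructor
  · rintro ⟨i, hi, rfl⟩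
    simp at hi ⊢
    omega
  · intro h
    exact ⟨p, by simp [h, p.2], by simp⟩

lemma sum_map_take_finRange (m : ℕ) (f : Fin n → ℚ) :
    (((List.finRange n).take m).map f).sum = ∑ p : Fin n with Fin.val p < m, f p := by
  rw [← List.sum_toFinset f ((List.nodup_finRange n).sublist (List.take_sublist _ _))]
  congr 1
  ext p
  simp [mem_take_finRange]

lemma history_take_arrivals (A : OnlineAlgorithm) (I : Instance n) (π : Equiv.Perm (Fin n))
    (m : ℕ) :
    A.history n I.capacity ((I.arrivals π).take m) =
      ((List.finRange n).take m).map fun p => (I.item (π.symm p), A.packing I π (π.symm p)) := by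
  induction m with
  | zero => simp [OnlineAlgorithm.history]
  | succ m ih =>
    rcases lt_or_ge m n with hm | hm
    · have h1 : (I.arrivals π).take (m + 1) =
          (I.arrivals π).take m ++ [I.item (π.symm ⟨m, hm⟩)] := by
        rw [List.take_add_one]
        simp [Instance.arrivals, hm]
      have h2 : (List.finRange n).take (m + 1) = (List.finRange n).take m ++ [⟨m, hm⟩] := by
        rw [List.take_add_one]
        simp [hm]
      have h3 : A.history n I.capacity ((I.arrivals π).take (m + 1)) =
          A.history n I.capacity ((I.arrivals π).take m) ++
            [(I.item (π.symm ⟨m, hm⟩), A.packing I π (π.symm ⟨m, hm⟩))] := by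
        rw [h1]
        simp [OnlineAlgorithm.history, OnlineAlgorithm.packing]
      rw [h3, h2, List.map_append, ih]
      simp
    · have h1 : (I.arrivals π).take (m + 1) = (I.arrivals π).take m := by
        rw [List.take_of_length_le, List.take_of_length_le] <;> simp [Instance.arrivals] <;> omega
      have h2 : (List.finRange n).take (m + 1) = (List.finRange n).take m := by
        rw [List.take_of_length_le, List.take_of_length_le] <;> simp <;> omega
      rw [h1, h2, ih]

/-- `optimalFraction` for the items revealed up to round `ℓ` is the greedy packing of the set of
these items. -/
lemma optimalFraction_arrivals (I : Instance n) (π : Equiv.Perm (Fin n)) (ℓ i : Fin n) :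
    optimalFraction I.capacity
      ((((List.finRange n).take ℓ).map fun p => I.item (π.symm p)) ++ [I.item (π.symm ℓ)])
      (I.item i) = I.greedy (arrived π (ℓ + 1)) i := by
  have h2 : (List.finRange n).take (ℓ + 1) = (List.finRange n).take ℓ ++ [ℓ] := by
    rw [List.take_add_one]
    simp
  have h3 : ((((List.finRange n).take ℓ).map fun p => I.item (π.symm p)) ++ [I.item (π.symm ℓ)]) =
      ((List.finRange n).take (ℓ + 1)).map fun p => I.item (π.symm p) := by
    rw [h2]
    simp
  -- A sum over the items of larger key, as a sum of conditional terms over all items.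
  have h4 : ∀ L : List (Fin n),
      (((L.map fun p => I.item (π.symm p)).filter
          fun j => (I.item i).densityKey I.capacity < j.densityKey I.capacity).map
        Item.size).sum =
      (L.map fun p => if I.greedyKey i < I.greedyKey (π.symm p) then (I.item (π.symm p)).size
        else 0).sum := by
    intro L
    induction L with
    | nil => simp
    | cons a L ih =>
      by_cases h : I.greedyKey i < I.greedyKey (π.symm a)
      · have h' : (I.item i).densityKey I.capacity <
          (I.item (π.symm a)).densityKey I.capacity := h
        simp [h, h', ih]
      · have h' : ¬ (I.item i).densityKey I.capacity <
          (I.item (π.symm a)).densityKey I.capacity := h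
        simp [h, h', ih]
  rw [h3, optimalFraction, h4, sum_map_take_finRange,
    sum_rounds_eq_sum_arrived π _ fun i' => if I.greedyKey i < I.greedyKey i' then
      (I.item i').size else 0, ← Finset.sum_filter]
  rfl

/-- The fraction that `threePhase` with phases ending after the rounds `C` and `D` packs of the
item of round `ℓ` (counted from `0`) if there is enough free capacity. -/
def target (I : Instance n) (C D : ℕ) (π : Equiv.Perm (Fin n)) (ℓ : Fin n) : ℚ :=
  if (ℓ : ℕ) < C then 0
  else if (ℓ : ℕ) < D then
    if ∀ i ∈ arrived π C, I.secretaryKey i < I.secretaryKey (π.symm ℓ) then 1 else 0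
  else I.greedy (arrived π (ℓ + 1)) (π.symm ℓ)

lemma target_nonneg (I : Instance n) (C D : ℕ) (π : Equiv.Perm (Fin n)) (ℓ : Fin n) :
    0 ≤ target I C D π ℓ := by
  unfold target
  split_ifs <;> simp [I.greedy_nonneg]

lemma target_le_one (I : Instance n) (C D : ℕ) (π : Equiv.Perm (Fin n)) (ℓ : Fin n) :
    target I C D π ℓ ≤ 1 := by
  unfold target
  split_ifs <;> simp [I.greedy_le_one]

/-- The free capacity of `A` before round `ℓ` (counted from `0`). -/
def free (A : OnlineAlgorithm) (I : Instance n) (π : Equiv.Perm (Fin n)) (ℓ : ℕ) : ℚ :=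
  I.capacity -
    ∑ p : Fin n with Fin.val p < ℓ, (I.item (π.symm p)).size * A.packing I π (π.symm p)

lemma free_succ (A : OnlineAlgorithm) (I : Instance n) (π : Equiv.Perm (Fin n)) (ℓ : Fin n) :
    free A I π (ℓ + 1) =
      free A I π ℓ - (I.item (π.symm ℓ)).size * A.packing I π (π.symm ℓ) := by
  have h : ({p | (p : ℕ) < ℓ + 1} : Finset (Fin n)) =
      insert ℓ ({p | (p : ℕ) < ℓ} : Finset (Fin n)) := by
    ext p
    simp [Fin.ext_iff]
    omega
  unfold free
  rw [h, Finset.sum_insert (by simp)]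
  ring

/-- Unless the free capacity is exceeded, the algorithm packs its target, cut at the free
capacity. -/
lemma size_mul_packing_threePhase (c d : ℚ) (I : Instance n) (π : Equiv.Perm (Fin n)) (ℓ : Fin n)
    (hfree : 0 ≤ free (threePhase c d) I π ℓ) :
    (I.item (π.symm ℓ)).size * (threePhase c d).packing I π (π.symm ℓ) =
      min ((I.item (π.symm ℓ)).size * target I ⌊c * n⌋₊ ⌊d * n⌋₊ π ℓ)
        (free (threePhase c d) I π ℓ) := by
  have hs := I.size_pos (π.symm ℓ)
  have hsum : I.capacity - ((((List.finRange n).take ℓ).map fun p =>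
      (I.item (π.symm p), (threePhase c d).packing I π (π.symm p))).map
        fun p : Item × ℚ => p.1.size * p.2).sum = free (threePhase c d) I π ℓ := by
    rw [List.map_map, sum_map_take_finRange]
    rfl
  have hlen : (((List.finRange n).take ℓ).map fun p =>
      (I.item (π.symm p), (threePhase c d).packing I π (π.symm p))).length = (ℓ : ℕ) := by
    simp
  have hsec : ⌊c * n⌋₊ ≤ (ℓ : ℕ) →
      ((∀ p ∈ (((List.finRange n).take ℓ).map fun p =>
        (I.item (π.symm p), (threePhase c d).packing I π (π.symm p))).take ⌊c * n⌋₊,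
          p.1.profitKey I.capacity < (I.item (π.symm ℓ)).profitKey I.capacity) ↔
      ∀ i ∈ arrived π ⌊c * n⌋₊, I.secretaryKey i < I.secretaryKey (π.symm ℓ)) := by
    intro hC
    rw [← List.map_take, List.take_take, min_eq_left hC, List.forall_mem_map]
    constructor
    · intro h i hi
      have := h (π i) (mem_take_finRange.2 (mem_arrived.1 hi))
      rwa [Equiv.symm_apply_apply] at this
    · intro h p hp
      exact h _ (by simpa using mem_take_finRange.1 hp)
  have hdec : (threePhase c d).packing I π (π.symm ℓ) = threePhase c d n I.capacity
      (((List.finRange n).take ℓ).map fun p =>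
        (I.item (π.symm p), (threePhase c d).packing I π (π.symm p))) (I.item (π.symm ℓ)) := by
    conv_lhs => rw [OnlineAlgorithm.packing, Equiv.apply_symm_apply, history_take_arrivals]
  rw [hdec, threePhase]
  simp only [hsum, hlen]
  unfold target
  split_ifs with h1 h2 h3 h4 h4
  · simp [hfree]
  · rw [mul_one, ← mul_assoc, mul_one_div_cancel hs.ne', one_mul]
  · exact absurd ((hsec (not_lt.1 h1)).1 h3) h4
  · exact absurd ((hsec (not_lt.1 h1)).2 h4) h3
  · simp [hfree]
  · rw [← mul_assoc, mul_one_div_cancel hs.ne', one_mul, List.map_map]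
    congr 2
    exact optimalFraction_arrivals I π ℓ (π.symm ℓ)

lemma free_nonneg (c d : ℚ) (I : Instance n) (π : Equiv.Perm (Fin n)) (ℓ : ℕ) (hℓ : ℓ ≤ n) :
    0 ≤ free (threePhase c d) I π ℓ := by
  induction ℓ with
  | zero => simp [free, I.capacity_pos.le]
  | succ m ih =>
    have hm := ih (by omega)
    rw [show m = ((⟨m, hℓ⟩ : Fin n) : ℕ) from rfl] at hm ⊢
    rw [free_succ, size_mul_packing_threePhase c d I π _ hm, sub_nonneg]
    exact min_le_right _ _

lemma size_mul_packing (c d : ℚ) (I : Instance n) (π : Equiv.Perm (Fin n)) (ℓ : Fin n) :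
    (I.item (π.symm ℓ)).size * (threePhase c d).packing I π (π.symm ℓ) =
      min ((I.item (π.symm ℓ)).size * target I ⌊c * n⌋₊ ⌊d * n⌋₊ π ℓ)
        (free (threePhase c d) I π ℓ) :=
  size_mul_packing_threePhase c d I π ℓ (free_nonneg c d I π ℓ ℓ.2.le)

lemma packing_nonneg (c d : ℚ) (I : Instance n) (π : Equiv.Perm (Fin n)) (i : Fin n) :
    0 ≤ (threePhase c d).packing I π i := by
  obtain ⟨ℓ, rfl⟩ := π.symm.surjective i
  have hs := I.size_pos (π.symm ℓ)
  refine nonneg_of_mul_nonneg_right ?_ hs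
  rw [size_mul_packing]
  exact le_min (mul_nonneg hs.le (target_nonneg ..)) (free_nonneg c d I π ℓ ℓ.2.le)

lemma packing_le_target (c d : ℚ) (I : Instance n) (π : Equiv.Perm (Fin n)) (ℓ : Fin n) :
    (threePhase c d).packing I π (π.symm ℓ) ≤ target I ⌊c * n⌋₊ ⌊d * n⌋₊ π ℓ := by
  refine le_of_mul_le_mul_left ?_ (I.size_pos (π.symm ℓ))
  rw [size_mul_packing]
  exact min_le_left _ _

theorem isFeasible_threePhase (c d : ℚ) : (threePhase c d).IsFeasible := by
  intro n I π
  refine ⟨fun i => ⟨packing_nonneg c d I π i, ?_⟩, ?_⟩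
  · obtain ⟨ℓ, rfl⟩ := π.symm.surjective i
    exact (packing_le_target c d I π ℓ).trans (target_le_one ..)
  · have h := free_nonneg c d I π n le_rfl
    simp only [free, Fin.is_lt, Finset.filter_true, sub_nonneg] at h
    rwa [Equiv.sum_comp π.symm fun i => (I.item i).size * (threePhase c d).packing I π i] at h

/-! ### The event that the secretary phase packs nothing -/

/-- The indicator of `i` being the most profitable item of `S`. -/
def topIndicator (I : Instance n) (S : Finset (Fin n)) (i : Fin n) : ℚ :=
  if i ∈ S ∧ ∀ j ∈ S, I.secretaryKey j ≤ I.secretaryKey i then 1 else 0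

lemma exists_topIndicator_eq (I : Instance n) {S : Finset (Fin n)} (hS : S.Nonempty) :
    ∃ t ∈ S, (∀ j ∈ S, I.secretaryKey j ≤ I.secretaryKey t) ∧
      ∀ i, topIndicator I S i = if i = t then 1 else 0 := by
  obtain ⟨t, ht, hmax⟩ := S.exists_max_image I.secretaryKey hS
  refine ⟨t, ht, hmax, fun i => ?_⟩
  unfold topIndicator
  congr 1
  rw [eq_iff_iff]
  constructor
  · rintro ⟨hi, h⟩
    exact I.secretaryKey_injective (le_antisymm (hmax i hi) (h t ht))
  · rintro rfl
    exact ⟨ht, hmax⟩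

/-- The indicator of the event that the most profitable item of the first `D` rounds arrives in
the first `C` rounds. On this event no item of the rounds `C, …, D - 1` is packed. -/
def noSecretary (I : Instance n) (C D : ℕ) (π : Equiv.Perm (Fin n)) : ℚ :=
  ∑ i ∈ arrived π C, topIndicator I (arrived π D) i

lemma arrived_nonempty {D : ℕ} (hD : 0 < D) (hn : D ≤ n) (π : Equiv.Perm (Fin n)) :
    (arrived π D).Nonempty :=
  ⟨π.symm ⟨0, by omega⟩, by simpa using hD⟩

lemma noSecretary_cases (I : Instance n) {C D : ℕ} (hD : 0 < D) (hn : D ≤ n)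
    (π : Equiv.Perm (Fin n)) :
    noSecretary I C D π = 0 ∨
      noSecretary I C D π = 1 ∧
        ∃ t ∈ arrived π C, ∀ j ∈ arrived π D, I.secretaryKey j ≤ I.secretaryKey t := by
  obtain ⟨t, -, hmax, htop⟩ := exists_topIndicator_eq I (arrived_nonempty hD hn π)
  unfold noSecretary
  simp only [htop, Finset.sum_ite_eq']
  by_cases h : t ∈ arrived π C
  · exact Or.inr ⟨if_pos h, t, h, hmax⟩
  · exact Or.inl (if_neg h)

/-- The event has probability `C / D`, and is independent of everything that does not depend on
the order among the first `D` rounds. -/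
lemma mul_sum_noSecretary (I : Instance n) {C D : ℕ} (hCD : C ≤ D) (hD : 0 < D) (hn : D ≤ n)
    {F : Equiv.Perm (Fin n) → ℚ} (hF : IsPrefixSymmetric D F) :
    (D : ℚ) * ∑ π, noSecretary I C D π * F π = C * ∑ π, F π := by
  have key : ∀ p ∈ ({p : Fin n | (p : ℕ) < C} : Finset (Fin n)),
      (D : ℚ) * ∑ π, topIndicator I (arrived π D) (π.symm p) * F π = ∑ π, F π := by
    intro p hp
    have hp' : (p : ℕ) < C := by simpa using hp
    rw [mul_sum_symm_apply hn (fun π i => topIndicator I (arrived π D) i * F π) ?_ p (by omega)]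
    · refine Finset.sum_congr rfl fun π _ => ?_
      obtain ⟨t, ht, -, htop⟩ := exists_topIndicator_eq I (arrived_nonempty hD hn π)
      simp [htop, mem_arrived.1 ht]
    · intro j k hj hk π
      simp only [hF j k hj hk π, isPrefixSymmetric_arrived le_rfl j k hj hk π]
  have h : ∀ π : Equiv.Perm (Fin n), noSecretary I C D π * F π =
      ∑ p : Fin n with Fin.val p < C, topIndicator I (arrived π D) (π.symm p) * F π := by
    intro π
    rw [← Finset.sum_mul, sum_rounds_eq_sum_arrived]
    rfl
  simp_rw [h]
  rw [Finset.sum_comm, Finset.mul_sum, Finset.sum_congr rfl key, Finset.sum_const,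
    Fin.card_filter_val_lt, min_eq_right (by omega), nsmul_eq_mul]

/-! ### The knapsack phase -/

/-- The fraction of the item of round `ℓ` in the greedy packing of the items revealed so far. -/
def roundFraction (I : Instance n) (π : Equiv.Perm (Fin n)) (ℓ : Fin n) : ℚ :=
  I.greedy (arrived π (ℓ + 1)) (π.symm ℓ)

/-- The size that the item of round `ℓ` takes in the greedy packing of the items revealed so
far. -/
def load (I : Instance n) (π : Equiv.Perm (Fin n)) (ℓ : Fin n) : ℚ :=
  (I.item (π.symm ℓ)).size * roundFraction I π ℓ

/-- The profit of the item of round `ℓ` in the greedy packing of the items revealed so far. -/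
def gain (I : Instance n) (π : Equiv.Perm (Fin n)) (ℓ : Fin n) : ℚ :=
  (I.item (π.symm ℓ)).value * roundFraction I π ℓ

lemma gain_nonneg (I : Instance n) (π : Equiv.Perm (Fin n)) (ℓ : Fin n) : 0 ≤ gain I π ℓ :=
  mul_nonneg (I.value_nonneg _) (I.greedy_nonneg _ _)

lemma isPrefixSymmetric_roundFraction (I : Instance n) {m : ℕ} (ℓ : Fin n) (h : m ≤ ℓ) :
    IsPrefixSymmetric m fun π => roundFraction I π ℓ := by
  intro j k hj hk π
  have h1 := isPrefixSymmetric_symm_apply ℓ h j k hj hk π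
  have h2 := isPrefixSymmetric_arrived (n := n) (show m ≤ ℓ + 1 by omega) j k hj hk π
  simp only at h1 h2
  simp only [roundFraction, h1, h2]

lemma isPrefixSymmetric_load (I : Instance n) {m : ℕ} (ℓ : Fin n) (h : m ≤ ℓ) :
    IsPrefixSymmetric m fun π => load I π ℓ := by
  intro j k hj hk π
  have h1 := isPrefixSymmetric_symm_apply ℓ h j k hj hk π
  have h2 := isPrefixSymmetric_roundFraction I ℓ h j k hj hk π
  simp only at h1 h2
  simp only [load, h1, h2]

lemma isPrefixSymmetric_gain (I : Instance n) {m : ℕ} (ℓ : Fin n) (h : m ≤ ℓ) :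
    IsPrefixSymmetric m fun π => gain I π ℓ := by
  intro j k hj hk π
  have h1 := isPrefixSymmetric_symm_apply ℓ h j k hj hk π
  have h2 := isPrefixSymmetric_roundFraction I ℓ h j k hj hk π
  simp only at h1 h2
  simp only [gain, h1, h2]

lemma load_le_capacity (I : Instance n) (π : Equiv.Perm (Fin n)) (ℓ : Fin n) :
    load I π ℓ ≤ I.capacity := by
  have hmem : π.symm ℓ ∈ arrived π (ℓ + 1) := by simp
  refine (Finset.single_le_sum (f := fun i => (I.item i).size * I.greedy (arrived π (ℓ + 1)) i)
    (fun i _ => mul_nonneg (I.size_pos i).le (I.greedy_nonneg _ _)) hmem).trans ?_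
  rw [I.sum_size_mul_greedy]
  exact min_le_left _ _

/-- If the secretary phase packs nothing, then the free capacity in the knapsack phase is at least
the capacity minus the loads of the earlier rounds of this phase. -/
lemma capacity_sub_le_free (c d : ℚ) (I : Instance n) (hCD : ⌊c * n⌋₊ ≤ ⌊d * n⌋₊)
    (π : Equiv.Perm (Fin n)) (ℓ : Fin n) {t : Fin n} (ht : t ∈ arrived π ⌊c * n⌋₊)
    (hmax : ∀ j ∈ arrived π ⌊d * n⌋₊, I.secretaryKey j ≤ I.secretaryKey t) :
    I.capacity - ∑ p : Fin n with ⌊d * n⌋₊ ≤ Fin.val p ∧ p < ℓ, load I π p ≤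
      free (threePhase c d) I π ℓ := by
  unfold free
  refine sub_le_sub_left ?_ _
  have h : ({p | ⌊d * n⌋₊ ≤ Fin.val p ∧ p < ℓ} : Finset (Fin n)) =
      ({p | Fin.val p < ℓ} : Finset (Fin n)).filter fun p => ⌊d * n⌋₊ ≤ Fin.val p := by
    ext p
    simp [and_comm]
  rw [h, Finset.sum_filter (fun p : Fin n => ⌊d * n⌋₊ ≤ (p : ℕ))]
  refine Finset.sum_le_sum fun p _ => ?_
  refine (mul_le_mul_of_nonneg_left (packing_le_target c d I π p) (I.size_pos _).le).trans ?_
  split_ifs with hp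
  · unfold target
    rw [if_neg (by omega), if_neg (by omega)]
    rfl
  · unfold target
    have hsec : ¬ ∀ i ∈ arrived π ⌊c * n⌋₊, I.secretaryKey i < I.secretaryKey (π.symm p) :=
      fun h2 => (hmax _ (by simpa using hp)).not_gt (h2 t ht)
    rw [if_pos (not_le.1 hp), if_neg hsec]
    simp

/-- With free capacity `R`, the item of round `ℓ` is packed at least to `R / W` times the extent
of the greedy packing. -/
lemma gain_mul_le (c d : ℚ) (I : Instance n) (hCD : ⌊c * n⌋₊ ≤ ⌊d * n⌋₊) (hD : 0 < ⌊d * n⌋₊)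
    (hn : ⌊d * n⌋₊ ≤ n) (π : Equiv.Perm (Fin n)) (ℓ : Fin n) (hℓ : ⌊d * n⌋₊ ≤ ℓ) :
    noSecretary I ⌊c * n⌋₊ ⌊d * n⌋₊ π *
        (gain I π ℓ *
          (1 - (∑ p : Fin n with ⌊d * n⌋₊ ≤ Fin.val p ∧ p < ℓ, load I π p) / I.capacity)) ≤
      (I.item (π.symm ℓ)).value * (threePhase c d).packing I π (π.symm ℓ) := by
  rcases noSecretary_cases I (C := ⌊c * n⌋₊) hD hn π with h0 | ⟨h1, t, ht, hmax⟩
  · rw [h0, zero_mul]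
    exact mul_nonneg (I.value_nonneg _) (packing_nonneg c d I π _)
  have hR := capacity_sub_le_free c d I hCD π ℓ ht hmax
  have hR0 := free_nonneg c d I π ℓ ℓ.2.le
  have hW := I.capacity_pos
  have hs := I.size_pos (π.symm ℓ)
  have hf := I.greedy_nonneg (arrived π (ℓ + 1)) (π.symm ℓ)
  have hload := load_le_capacity I π ℓ
  have hpack := size_mul_packing c d I π ℓ
  have htarget : target I ⌊c * n⌋₊ ⌊d * n⌋₊ π ℓ = roundFraction I π ℓ := by
    unfold target
    rw [if_neg (by omega), if_neg (by omega)]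
    rfl
  rw [htarget] at hpack
  set R := free (threePhase c d) I π ℓ
  have hRW : R ≤ I.capacity := by
    refine sub_le_self _ (Finset.sum_nonneg fun p _ => ?_)
    exact mul_nonneg (I.size_pos _).le (packing_nonneg c d I π _)
  have hload0 : 0 ≤ load I π ℓ := mul_nonneg hs.le hf
  have hmin : load I π ℓ * (R / I.capacity) ≤ min (load I π ℓ) R := by
    refine le_min (mul_le_of_le_one_right hload0 ((div_le_one hW).2 hRW)) ?_
    rw [mul_div_assoc', div_le_iff₀ hW, mul_comm]
    exact mul_le_mul_of_nonneg_left hload hR0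
  have hx : roundFraction I π ℓ * (R / I.capacity) ≤
      (threePhase c d).packing I π (π.symm ℓ) := by
    refine le_of_mul_le_mul_left ?_ hs
    rw [hpack, ← mul_assoc]
    exact hmin
  rw [h1, one_mul]
  calc gain I π ℓ * (1 - (∑ p : Fin n with ⌊d * n⌋₊ ≤ Fin.val p ∧ p < ℓ, load I π p) / I.capacity)
      ≤ gain I π ℓ * (R / I.capacity) := by
        refine mul_le_mul_of_nonneg_left ?_ (gain_nonneg I π ℓ)
        rw [one_sub_div hW.ne']
        exact div_le_div_of_nonneg_right hR hW.le
    _ = (I.item (π.symm ℓ)).value * (roundFraction I π ℓ * (R / I.capacity)) := by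
        rw [gain, mul_assoc]
    _ ≤ _ := mul_le_mul_of_nonneg_left hx (I.value_nonneg _)

/-! ### Expectations -/

/-- The expected gain of every round is at least `OPT / n`: the items revealed so far contain an
optimal packing in proportion to their number, and each of them is equally likely to be the last
one. -/
lemma factorial_mul_profit_le_sum_gain (I : Instance n) {y : Fin n → ℚ} (hy : I.IsPacking y)
    (ℓ : Fin n) : n.factorial * I.profit y ≤ n * ∑ π, gain I π ℓ := by
  have h1 := mul_sum_symm_apply (m := ℓ + 1) ℓ.2
    (fun π i => (I.item i).value * I.greedy (arrived π (ℓ + 1)) i)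
    (fun j k hj hk π => by simp only [isPrefixSymmetric_arrived le_rfl j k hj hk π]) ℓ (by omega)
  have h2 := mul_sum_symm_apply (m := ℓ + 1) ℓ.2 (fun _ i => (I.item i).value * y i)
    (fun j k hj hk π => rfl) ℓ (by omega)
  have h3 := mul_sum_symm_apply (m := n) le_rfl (fun _ i => (I.item i).value * y i)
    (fun j k hj hk π => rfl) ℓ ℓ.2
  have h4 : ∑ π : Equiv.Perm (Fin n), ∑ i ∈ arrived π n, (I.item i).value * y i =
      n.factorial * I.profit y := by
    simp [arrived, Instance.profit, Fintype.card_perm]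
  rw [← h4, ← h3]
  refine mul_le_mul_of_nonneg_left ?_ (Nat.cast_nonneg n)
  have hpos : (0 : ℚ) < ((ℓ + 1 : ℕ) : ℚ) := by positivity
  refine le_of_mul_le_mul_left ?_ hpos
  rw [h2]
  refine le_of_le_of_eq ?_ h1.symm
  exact Finset.sum_le_sum fun π _ => I.sum_value_mul_le_greedy _ hy

/-- Given the set of the first `p + 1` items and everything that happens later, the expected load
of round `p` is at most `W / (p + 1)`. -/
lemma sum_gain_mul_load_le (I : Instance n) {p ℓ : Fin n} (h : p < ℓ) :
    ∑ π, gain I π ℓ * load I π p ≤ I.capacity * (∑ π, gain I π ℓ) * (1 / ((p : ℕ) + 1)) := by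
  have hp : ((p : ℕ) + 1) ≤ (ℓ : ℕ) := h
  have h1 := mul_sum_symm_apply (m := p + 1) p.2
    (fun π i => gain I π ℓ * ((I.item i).size * I.greedy (arrived π (p + 1)) i))
    (fun j k hj hk π => by
      have := isPrefixSymmetric_gain I ℓ hp j k hj hk π
      simp only at this
      simp only [this, isPrefixSymmetric_arrived le_rfl j k hj hk π]) p (by omega)
  rw [mul_one_div, le_div_iff₀ (by positivity), mul_comm]
  push_cast at h1
  refine h1.trans_le ?_
  rw [Finset.mul_sum]
  refine Finset.sum_le_sum fun π _ => ?_
  rw [← Finset.mul_sum, I.sum_size_mul_greedy, mul_comm I.capacity]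
  exact mul_le_mul_of_nonneg_left (min_le_left _ _) (gain_nonneg I π ℓ)

/-- The part of the harmonic sum that bounds the expected load of the rounds `D, …, ℓ - 1`. -/
def harmonicPart (D ℓ : ℕ) : ℚ := ∑ k ∈ Finset.Ico D ℓ, 1 / ((k : ℚ) + 1)

lemma sum_rounds_eq_harmonicPart (D : ℕ) (ℓ : Fin n) :
    ∑ p : Fin n with D ≤ Fin.val p ∧ p < ℓ, (1 / ((p : ℕ) + 1) : ℚ) = harmonicPart D ℓ := by
  unfold harmonicPart
  refine Finset.sum_bij (fun p _ => (p : ℕ)) ?_ ?_ ?_ ?_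
  · simp
  · intro a _ b _ hab
    exact Fin.ext hab
  · intro k hk
    have hk' := Finset.mem_Ico.1 hk
    exact ⟨⟨k, hk'.2.trans ℓ.2⟩, Finset.mem_filter.2 ⟨Finset.mem_univ _, hk'⟩, rfl⟩
  · simp

/-- The expected profit of round `ℓ` of the knapsack phase. -/
lemma mul_one_sub_harmonicPart_le (c d : ℚ) (I : Instance n) (hCD : ⌊c * n⌋₊ ≤ ⌊d * n⌋₊)
    (hD : 0 < ⌊d * n⌋₊) (hn : ⌊d * n⌋₊ ≤ n) {y : Fin n → ℚ} (hy : I.IsPacking y)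
    (ℓ : Fin n) (hℓ : ⌊d * n⌋₊ ≤ ℓ) :
    ⌊c * n⌋₊ * (n.factorial * I.profit y) * (1 - harmonicPart ⌊d * n⌋₊ ℓ) ≤
      n * ⌊d * n⌋₊ *
        ∑ π, (I.item (π.symm ℓ)).value * (threePhase c d).packing I π (π.symm ℓ) := by
  set C := ⌊c * n⌋₊
  set D := ⌊d * n⌋₊
  have hW := I.capacity_pos
  have hprofit : 0 ≤ I.profit y :=
    Finset.sum_nonneg fun i _ => mul_nonneg (I.value_nonneg i) (hy.1 i).1
  -- If the bound on the load exceeds the capacity, nonnegativity of the profit is enough.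
  rcases le_total (1 - harmonicPart D ℓ) 0 with hH | hH
  · refine (mul_nonpos_of_nonneg_of_nonpos (by positivity) hH).trans ?_
    refine mul_nonneg (by positivity) (Finset.sum_nonneg fun π _ => ?_)
    exact mul_nonneg (I.value_nonneg _) (packing_nonneg c d I π _)
  set F : Equiv.Perm (Fin n) → ℚ := fun π =>
    gain I π ℓ * (1 - (∑ p : Fin n with D ≤ Fin.val p ∧ p < ℓ, load I π p) / I.capacity) with hF
  have hFsymm : IsPrefixSymmetric D F := by
    intro j k hj hk π
    have h1 := isPrefixSymmetric_gain I ℓ hℓ j k hj hk π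
    have h2 : ∑ p : Fin n with D ≤ Fin.val p ∧ p < ℓ, load I (Equiv.swap j k * π) p =
        ∑ p : Fin n with D ≤ Fin.val p ∧ p < ℓ, load I π p :=
      Finset.sum_congr rfl fun p hp =>
        isPrefixSymmetric_load I p (Finset.mem_filter.1 hp).2.1 j k hj hk π
    simp only at h1
    simp only [hF, h1, h2]
  have hsumF : (∑ π, gain I π ℓ) * (1 - harmonicPart D ℓ) ≤ ∑ π, F π := by
    have h1 : ∑ π, F π = ∑ π, gain I π ℓ -
        (∑ p : Fin n with D ≤ Fin.val p ∧ p < ℓ, ∑ π, gain I π ℓ * load I π p) /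
          I.capacity := by
      rw [Finset.sum_comm, Finset.sum_div, ← Finset.sum_sub_distrib]
      refine Finset.sum_congr rfl fun π _ => ?_
      rw [hF, ← Finset.mul_sum]
      ring
    have h2 : ∑ p : Fin n with D ≤ Fin.val p ∧ p < ℓ, ∑ π, gain I π ℓ * load I π p ≤
        I.capacity * (∑ π, gain I π ℓ) * harmonicPart D ℓ := by
      rw [← sum_rounds_eq_harmonicPart, Finset.mul_sum]
      exact Finset.sum_le_sum fun p hp => sum_gain_mul_load_le I (Finset.mem_filter.1 hp).2.2
    rw [h1, mul_one_sub, sub_le_sub_iff_left, div_le_iff₀ hW]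
    linarith
  calc C * (n.factorial * I.profit y) * (1 - harmonicPart D ℓ)
      ≤ C * (n * ∑ π, gain I π ℓ) * (1 - harmonicPart D ℓ) := by
        have := factorial_mul_profit_le_sum_gain I hy ℓ
        gcongr
    _ = n * (C * ((∑ π, gain I π ℓ) * (1 - harmonicPart D ℓ))) := by ring
    _ ≤ n * (C * ∑ π, F π) := by gcongr
    _ = n * (D * ∑ π, noSecretary I C D π * F π) := by
        rw [mul_sum_noSecretary I hCD hD hn hFsymm]
    _ ≤ n * (D * ∑ π, (I.item (π.symm ℓ)).value * (threePhase c d).packing I π (π.symm ℓ)) := by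
        have : ∀ π, noSecretary I C D π * F π ≤
          (I.item (π.symm ℓ)).value * (threePhase c d).packing I π (π.symm ℓ) :=
            fun π => gain_mul_le c d I hCD hD hn π ℓ hℓ
        have := Finset.sum_le_sum fun π (_ : π ∈ Finset.univ) => this π
        exact mul_le_mul_of_nonneg_left (mul_le_mul_of_nonneg_left this (by positivity))
          (by positivity)
    _ = _ := by ring

lemma sum_one_sub_harmonicPart (D n : ℕ) (h : D ≤ n) :
    ∑ ℓ ∈ Finset.Ico D n, (1 - harmonicPart D ℓ) = 2 * ((n : ℚ) - D) - n * harmonicPart D n := by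
  induction n, h using Nat.le_induction with
  | base => simp [harmonicPart]
  | succ m hm ih =>
    have hH : harmonicPart D (m + 1) = harmonicPart D m + 1 / ((m : ℚ) + 1) :=
      Finset.sum_Ico_succ_top hm _
    rw [Finset.sum_Ico_succ_top hm, ih, hH]
    push_cast
    field_simp
    ring

/-- The total expected profit of the knapsack phase. -/
lemma mul_profit_le_expectedProfit (c d : ℚ) (I : Instance n) (hCD : ⌊c * n⌋₊ ≤ ⌊d * n⌋₊)
    (hD : 0 < ⌊d * n⌋₊) (hn : ⌊d * n⌋₊ ≤ n) {y : Fin n → ℚ} (hy : I.IsPacking y) :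
    (⌊c * n⌋₊ : ℚ) / ⌊d * n⌋₊ *
        (2 * (1 - (⌊d * n⌋₊ : ℚ) / n) - harmonicPart ⌊d * n⌋₊ n) * I.profit y ≤
      (threePhase c d).expectedProfit I := by
  set C := ⌊c * n⌋₊
  set D := ⌊d * n⌋₊
  have hDpos : (0 : ℚ) < D := by exact_mod_cast hD
  have hnpos : (0 : ℚ) < n := by exact_mod_cast hD.trans_le hn
  have hfact : (0 : ℚ) < n.factorial := by exact_mod_cast n.factorial_pos
  have h1 : ∑ ℓ : Fin n with D ≤ Fin.val ℓ, (1 - harmonicPart D ℓ) =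
      2 * ((n : ℚ) - D) - n * harmonicPart D n := by
    rw [← sum_one_sub_harmonicPart D n hn]
    refine Finset.sum_bij (fun p _ => (p : ℕ)) ?_ ?_ ?_ ?_
    · simp
    · intro a _ b _ hab
      exact Fin.ext hab
    · intro k hk
      have hk' := Finset.mem_Ico.1 hk
      exact ⟨⟨k, hk'.2⟩, by simpa using hk'.1, rfl⟩
    · simp
  have h2 : ∑ ℓ : Fin n with D ≤ Fin.val ℓ,
      ∑ π, (I.item (π.symm ℓ)).value * (threePhase c d).packing I π (π.symm ℓ) ≤
      ∑ π, I.profit ((threePhase c d).packing I π) := by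
    rw [Finset.sum_comm]
    refine Finset.sum_le_sum fun π _ => ?_
    unfold Instance.profit
    rw [← Equiv.sum_comp π.symm]
    exact Finset.sum_le_univ_sum_of_nonneg fun ℓ =>
      mul_nonneg (I.value_nonneg _) (packing_nonneg c d I π _)
  have h3 := Finset.sum_le_sum fun ℓ (hℓ : ℓ ∈ ({ℓ | D ≤ Fin.val ℓ} : Finset (Fin n))) =>
    mul_one_sub_harmonicPart_le c d I hCD hD hn hy ℓ (Finset.mem_filter.1 hℓ).2
  rw [← Finset.mul_sum, ← Finset.mul_sum, h1] at h3
  have h4 : C * (n.factorial * I.profit y) * (2 * ((n : ℚ) - D) - n * harmonicPart D n) ≤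
      n * D * ∑ π, I.profit ((threePhase c d).packing I π) :=
    h3.trans (mul_le_mul_of_nonneg_left h2 (by positivity))
  unfold OnlineAlgorithm.expectedProfit
  rw [le_div_iff₀ hfact]
  refine le_of_mul_le_mul_left (le_of_eq_of_le ?_ h4) (mul_pos hnpos hDpos)
  clear_value C D
  field_simp

/-! ### The limit of the competitive ratio -/

lemma harmonicPart_le_log {D n : ℕ} (hD : 0 < D) (h : D ≤ n) :
    (harmonicPart D n : ℝ) ≤ -Real.log ((D : ℝ) / n) := by
  have hD' : (0 : ℝ) < D := by exact_mod_cast hD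
  induction n, h using Nat.le_induction with
  | base => simp [harmonicPart, hD'.ne']
  | succ m hm ih =>
    have hm' : (0 : ℝ) < m := by exact_mod_cast hD.trans_le hm
    have hH : harmonicPart D (m + 1) = harmonicPart D m + 1 / ((m : ℚ) + 1) :=
      Finset.sum_Ico_succ_top hm _
    have hlog := Real.log_le_sub_one_of_pos (show (0 : ℝ) < m / (m + 1) by positivity)
    rw [Real.log_div hD'.ne' hm'.ne'] at ih
    rw [Real.log_div hm'.ne' (by positivity)] at hlog
    have hfrac : (m : ℝ) / (m + 1) - 1 = -(1 / (m + 1)) := by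
      field_simp
      ring
    rw [hH, Nat.cast_succ, Real.log_div hD'.ne' (by positivity)]
    push_cast
    linarith

/-- The lower bound on the competitive ratio tends to `c / d * (2 - 2 * d + log d)`. -/
lemma tendsto_ratio {c d : ℚ} (hc : 0 ≤ c) (hd : 0 < d) :
    Tendsto (fun n : ℕ => ((⌊c * n⌋₊ : ℝ) / n) / ((⌊d * n⌋₊ : ℝ) / n) *
      (2 * (1 - (⌊d * n⌋₊ : ℝ) / n) + Real.log ((⌊d * n⌋₊ : ℝ) / n))) atTop
      (𝓝 ((c : ℝ) / d * (2 * (1 - d) + Real.log d))) := by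
  have key : ∀ q : ℚ, 0 ≤ q →
      Tendsto (fun n : ℕ => (⌊q * n⌋₊ : ℝ) / n) atTop (𝓝 (q : ℝ)) := by
    intro q hq
    have h := (tendsto_nat_floor_mul_div_atTop (R := ℝ) (a := (q : ℝ))
      (by exact_mod_cast hq)).comp tendsto_natCast_atTop_atTop
    refine h.congr fun n => ?_
    have : ⌊(q : ℝ) * (n : ℝ)⌋₊ = ⌊q * n⌋₊ := by
      rw [← Int.floor_toNat, ← Int.floor_toNat, ← Rat.floor_cast (α := ℝ) (q * n)]
      push_cast
      rfl
    simp only [Function.comp_apply, this]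
  have hd' : (d : ℝ) ≠ 0 := by exact_mod_cast hd.ne'
  have h1 := key c hc
  have h2 := key d hd.le
  exact (h1.div h2 hd').mul (((h2.const_sub 1).const_mul 2).add (h2.log hd'))

lemma neg_lt_log : (-0.5089 : ℝ) < Real.log 0.60138 := by
  rw [Real.lt_log_iff_exp_lt (by norm_num), Real.exp_neg, inv_lt_comm₀ (Real.exp_pos _)
    (by norm_num)]
  refine lt_of_lt_of_le ?_ (Real.sum_le_exp_of_nonneg (by norm_num) 7)
  norm_num [Finset.sum_range_succ, Nat.factorial]

lemma one_div_lt_ratio :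
    (1 / 4.39 : ℝ) < ((0.47521 : ℚ) : ℝ) / ((0.60138 : ℚ) : ℝ) *
      (2 * (1 - ((0.60138 : ℚ) : ℝ)) + Real.log ((0.60138 : ℚ) : ℝ)) := by
  have h := neg_lt_log
  have e1 : ((0.47521 : ℚ) : ℝ) = 0.47521 := by norm_num
  have e2 : ((0.60138 : ℚ) : ℝ) = 0.60138 := by norm_num
  rw [e1, e2]
  calc (1 / 4.39 : ℝ) < 0.47521 / 0.60138 * (2 * (1 - 0.60138) + -0.5089) := by norm_num
    _ < _ := by gcongr

lemma expectedProfit_nonneg (c d : ℚ) (I : Instance n) :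
    0 ≤ (threePhase c d).expectedProfit I :=
  div_nonneg (Finset.sum_nonneg fun π _ => Finset.sum_nonneg fun i _ =>
    mul_nonneg (I.value_nonneg i) (packing_nonneg c d I π i)) (Nat.cast_nonneg _)

lemma mul_opt_le (I : Instance n) {a b : ℝ} (ha : 0 ≤ a)
    (h : ∀ y, I.IsPacking y → a * (I.profit y : ℝ) ≤ b) : a * I.opt ≤ b := by
  have h0 : I.IsPacking 0 := ⟨by simp, by simp [I.capacity_pos.le]⟩
  rcases ha.eq_or_lt with rfl | ha
  · simpa using h 0 h0
  · rw [← le_div_iff₀' ha]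
    refine csSup_le ⟨_, 0, h0, rfl⟩ ?_
    rintro p ⟨y, hy, rfl⟩
    rw [le_div_iff₀' ha]
    exact h y hy

/-- A parameter choice `c ≤ d ≤ 1` gives every competitive ratio `r` for which `1 / r` is less
than `c / d * (2 - 2 * d + log d)`. -/
theorem isCompetitive_threePhase {c d : ℚ} {r : ℝ} (hc : 0 ≤ c) (hd : 0 < d) (hcd : c ≤ d)
    (hd1 : d ≤ 1) (hr : 0 < r)
    (h : 1 / r < (c : ℝ) / d * (2 * (1 - d) + Real.log d)) :
    (threePhase c d).IsCompetitive r := by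
  obtain ⟨N, hN⟩ := eventually_atTop.1 ((tendsto_ratio hc hd).eventually (lt_mem_nhds h))
  obtain ⟨M, hM⟩ := exists_nat_ge (1 / d)
  refine ⟨fun n => if N ≤ n ∧ M ≤ n then 0 else 1 / r, ?_, fun n I => ?_⟩
  · refine tendsto_const_nhds.congr' ?_
    filter_upwards [eventually_ge_atTop N, eventually_ge_atTop M] with n h1 h2
    rw [if_pos ⟨h1, h2⟩]
  have hnonneg : (0 : ℝ) ≤ ((threePhase c d).expectedProfit I : ℝ) := by
    exact_mod_cast expectedProfit_nonneg c d I
  by_cases hn : N ≤ n ∧ M ≤ n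
  · simp only [if_pos hn, sub_zero]
    refine mul_opt_le I (by positivity) fun y hy => ?_
    have hMn : 1 / d ≤ (n : ℚ) := hM.trans (by exact_mod_cast hn.2)
    have hD : 0 < ⌊d * n⌋₊ := by
      rw [Nat.floor_pos, mul_comm]
      exact (div_le_iff₀ hd).1 hMn
    have hDn : ⌊d * n⌋₊ ≤ n :=
      Nat.floor_le_of_le (mul_le_of_le_one_left (Nat.cast_nonneg n) hd1)
    have hCD : ⌊c * n⌋₊ ≤ ⌊d * n⌋₊ := by gcongr
    have hprofit : (0 : ℝ) ≤ (I.profit y : ℝ) := by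
      exact_mod_cast Finset.sum_nonneg fun i _ => mul_nonneg (I.value_nonneg i) (hy.1 i).1
    have hbound : ((⌊c * n⌋₊ : ℝ) / ⌊d * n⌋₊ *
        (2 * (1 - (⌊d * n⌋₊ : ℝ) / n) - harmonicPart ⌊d * n⌋₊ n) * I.profit y : ℝ) ≤
        ((threePhase c d).expectedProfit I : ℝ) := by
      have hQ := (Rat.cast_le (K := ℝ)).2 (mul_profit_le_expectedProfit c d I hCD hD hDn hy)
      push_cast at hQ
      exact hQ
    refine le_trans (mul_le_mul_of_nonneg_right ?_ hprofit) hbound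
    refine (hN n hn.1).le.trans ?_
    have hn0 : (n : ℝ) ≠ 0 := by exact_mod_cast (hD.trans_le hDn).ne'
    rw [div_div_div_cancel_right₀ hn0]
    refine mul_le_mul_of_nonneg_left ?_ (by positivity)
    have := harmonicPart_le_log hD hDn
    linarith
  · simpa only [if_neg hn, sub_self, zero_mul] using hnonneg

end FractionalKnapsack

theorem theorem1 :
    (FractionalKnapsack.threePhase 0.47521 0.60138).IsFeasible ∧
      (FractionalKnapsack.threePhase 0.47521 0.60138).IsCompetitive 4.39 :=
  ⟨FractionalKnapsack.isFeasible_threePhase _ _,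
    FractionalKnapsack.isCompetitive_threePhase (by norm_num) (by norm_num) (by norm_num)
      (by norm_num) (by norm_num) FractionalKnapsack.one_div_lt_ratio⟩
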